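/- For a group $G$ and a subset $S\subseteq G$, let $\mathrm{Cay}(G;S)$ be the Cayley digraph with vertex set $G$ and an arc $x\to xs$ for all $x\in G$, $s\in S$; if $S=S^{-1}$ it is regarded as an undirected graph, the Cayley graph. It is locally finite if every vertex has finitely many neighbours, i.e. if $S$ is finite. A Cayley digraph (respectively Cayley graph) $\mathrm{Cay}(G;S)$ is a DCI-graph (respectively CI-graph) if, whenever it is isomorphic to a Cayley digraph (respectively Cayley graph) $\mathrm{Cay}(G;S')$ on the same group, there is a group automorphism $\alpha$ of $G$ with $\alpha(S)=S'$. The group $G$ is a DCI-group (respectively CI-group) if every Cayley digraph (respectively Cayley graph) on $G$ is a DCI-graph (respectively CI-graph), and a strongly DCI$_f$-group (respectively strongly CI$_f$-group) if every locally finite Cayley digraph (respectively Cayley graph) on $G$ is a DCI-graph (respectively CI-graph). Theorem. Let $G$ be a countable (finite or countably infinite) abelian torsion group. Then: (1) $G$ is a strongly CI$_f$-group if and only if every finite subgroup of $G$ is a CI-group; (2) $G$ is a strongly DCI$_f$-group if and only if every finite subgroup of $G$ is a DCI-group. -/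

import Mathlib

open scoped Pointwise

/-- The Cayley digraph `Cay(G; S)`: vertex set `G`, with an arc from `x` to `x * s` for every
`x : G` and `s ∈ S`. If `S⁻¹ = S` the adjacency relation is symmetric and this is the (undirected)
Cayley graph. The connection set is an arbitrary subset of `G`; there are loops iff `1 ∈ S`. -/
def cayleyDigraph {G : Type*} [Group G] (S : Set G) : Digraph G where
  Adj x y := ∃ s ∈ S, x * s = y

theorem cayleyDigraph_adj {G : Type*} [Group G] (S : Set G) (x y : G) :
    (cayleyDigraph S).Adj x y ↔ x⁻¹ * y ∈ S := by
  constructor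
  · rintro ⟨s, hs, rfl⟩
    simpa using hs
  · intro h
    exact ⟨_, h, by simp⟩

/-- For an inverse-closed connection set, the adjacency relation is symmetric. -/
theorem cayleyDigraph_symm {G : Type*} [Group G] {S : Set G} (hS : S⁻¹ = S) (x y : G) :
    (cayleyDigraph S).Adj x y ↔ (cayleyDigraph S).Adj y x := by
  rw [cayleyDigraph_adj, cayleyDigraph_adj, ← hS, Set.mem_inv, mul_inv_rev, inv_inv, hS]

/-- For an inverse-closed connection set without the identity, this is the adjacency relation of
Mathlib's simple Cayley graph. -/
theorem cayleyDigraph_adj_iff_mulCayley {G : Type*} [Group G] {S : Set G} (hS : S⁻¹ = S)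
    (h1 : (1 : G) ∉ S) (x y : G) :
    (cayleyDigraph S).Adj x y ↔ (SimpleGraph.mulCayley S).Adj x y := by
  have h := cayleyDigraph_symm hS x y
  rw [SimpleGraph.mulCayley_adj, ← cayleyDigraph_adj, ← cayleyDigraph_adj, ← h, or_self]
  refine ⟨fun hxy => ⟨?_, hxy⟩, fun hxy => hxy.2⟩
  rintro rfl
  rw [cayleyDigraph_adj, inv_mul_cancel] at hxy
  exact h1 hxy

/-- A digraph is locally finite if every vertex has finitely many out-neighbours and finitely many
in-neighbours. -/
def Digraph.IsLocallyFinite {V : Type*} (Γ : Digraph V) : Prop :=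
  ∀ v : V, {w | Γ.Adj v w}.Finite ∧ {w | Γ.Adj w v}.Finite

/-- A Cayley digraph is locally finite iff its connection set is finite. -/
theorem cayleyDigraph_isLocallyFinite_iff {G : Type*} [Group G] (S : Set G) :
    (cayleyDigraph S).IsLocallyFinite ↔ S.Finite := by
  constructor
  · intro h
    simpa [cayleyDigraph_adj] using (h 1).1
  · intro h v
    constructor
    · refine (h.image fun s => v * s).subset ?_
      rintro w ⟨s, hs, rfl⟩
      exact ⟨s, hs, rfl⟩
    · refine (h.image fun s => v * s⁻¹).subset ?_
      rintro w ⟨s, hs, rfl⟩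
      exact ⟨s, hs, by simp⟩

/-- Two digraphs are isomorphic if some bijection of their vertex sets preserves adjacency in both
directions. -/
def Digraph.IsIsomorphic {V W : Type*} (Γ : Digraph V) (Δ : Digraph W) : Prop :=
  Nonempty (Γ.Adj ≃r Δ.Adj)

/-- The Cayley digraph `Cay(G; S)` is a DCI-graph: whenever it is isomorphic to a Cayley digraph
`Cay(G; S')`, some group automorphism of `G` maps `S` onto `S'`. -/
def IsDCIGraph {G : Type*} [Group G] (S : Set G) : Prop :=
  ∀ S' : Set G, (cayleyDigraph S).IsIsomorphic (cayleyDigraph S') →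
    ∃ α : G ≃* G, α '' S = S'

/-- The Cayley graph `Cay(G; S)` (meant for `S⁻¹ = S`) is a CI-graph: whenever it is isomorphic to
a Cayley graph `Cay(G; S')`, some group automorphism of `G` maps `S` onto `S'`. -/
def IsCIGraph {G : Type*} [Group G] (S : Set G) : Prop :=
  ∀ S' : Set G, S'⁻¹ = S' → (cayleyDigraph S).IsIsomorphic (cayleyDigraph S') →
    ∃ α : G ≃* G, α '' S = S'

/-- `G` is a DCI-group: every Cayley digraph on `G` is a DCI-graph. -/
def IsDCIGroup (G : Type*) [Group G] : Prop :=
  ∀ S : Set G, IsDCIGraph S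

/-- `G` is a CI-group: every Cayley graph on `G` is a CI-graph. -/
def IsCIGroup (G : Type*) [Group G] : Prop :=
  ∀ S : Set G, S⁻¹ = S → IsCIGraph S

/-- `G` is a strongly DCI_f-group: every locally finite Cayley digraph on `G` is a DCI-graph. -/
def IsStronglyDCIfGroup (G : Type*) [Group G] : Prop :=
  ∀ S : Set G, (cayleyDigraph S).IsLocallyFinite → IsDCIGraph S

/-- `G` is a strongly CI_f-group: every locally finite Cayley graph on `G` is a CI-graph. -/
def IsStronglyCIfGroup (G : Type*) [Group G] : Prop :=
  ∀ S : Set G, S⁻¹ = S → (cayleyDigraph S).IsLocallyFinite → IsCIGraph S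

/-! Both sides of each equivalence force `ElementaryOrUnique`. In a finite group, subgroups of equal
order, taken as connection sets, give isomorphic unions of complete graphs (with loops), so the CI
property makes such subgroups isomorphic. This rules out a cyclic group of order `p ^ 2` beside a
noncyclic one (`elementaryOrUnique_of_card_eq`).

Conversely, under this condition every injective homomorphism from a finite subgroup into the group
extends to an automorphism (`AddMonoidHom.exists_addEquiv_extend`): prime by prime, it is either
linear algebra over `ZMod p` or multiplication by an integer prime to `p`. Hence an automorphism
matching two connection sets passes between the group and a finite subgroup `H` in both directions.

Isomorphisms pass likewise. Upwards, they act coset by coset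
(`cayleyDigraph_isIsomorphic_of_subgroup`). Downwards, finitely many torsion elements generate a
finite `H`, and the components, cosets of the closures, are rematched inside `H`
(`cayleyDigraph_isIsomorphic_preimage`). -/

/-! ### Cayley digraph isomorphisms built coset by coset -/

theorem QuotientGroup.mk_out_mul_coe {G : Type*} [Group G] {K : Subgroup G} (q : G ⧸ K) (k : K) :
    ((q.out * k : G) : G ⧸ K) = q := by
  rw [QuotientGroup.mk_mul_of_mem _ k.2, QuotientGroup.out_eq']

/-- The position of `x` inside its left coset, relative to the chosen representative. -/
noncomputable def Subgroup.cosetCoord {G : Type*} [Group G] (K : Subgroup G) (x : G) : K :=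
  ⟨(x : G ⧸ K).out⁻¹ * x, QuotientGroup.eq.1 (QuotientGroup.out_eq' _)⟩

theorem Subgroup.out_mul_cosetCoord {G : Type*} [Group G] (K : Subgroup G) (x : G) :
    (x : G ⧸ K).out * (K.cosetCoord x : G) = x := by
  simp [Subgroup.cosetCoord]

theorem Subgroup.cosetCoord_out_mul {G : Type*} [Group G] (K : Subgroup G) (q : G ⧸ K) (k : K) :
    K.cosetCoord (q.out * k) = k := by
  apply Subtype.ext
  simp only [Subgroup.cosetCoord]
  rw [QuotientGroup.mk_out_mul_coe, inv_mul_cancel_left]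

/-- The bijection of a group obtained from a bijection between two subgroups and a bijection
between their left coset spaces. -/
noncomputable def Subgroup.equivOfCosets {G : Type*} [Group G] {K K' : Subgroup G} (e : K ≃ K')
    (σ : G ⧸ K ≃ G ⧸ K') : G ≃ G where
  toFun x := (σ x).out * e (K.cosetCoord x)
  invFun y := (σ.symm y).out * e.symm (K'.cosetCoord y)
  left_inv x := by
    dsimp only
    rw [QuotientGroup.mk_out_mul_coe, Subgroup.cosetCoord_out_mul, Equiv.symm_apply_apply,
      Equiv.symm_apply_apply, Subgroup.out_mul_cosetCoord]
  right_inv y := by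
    dsimp only
    rw [QuotientGroup.mk_out_mul_coe, Subgroup.cosetCoord_out_mul, Equiv.apply_symm_apply,
      Equiv.apply_symm_apply, Subgroup.out_mul_cosetCoord]

/-- Cayley digraphs whose connection sets lie in subgroups `K`, `K'` of the same index are
isomorphic as soon as their restrictions to `K` and `K'` are. -/
theorem cayleyDigraph_isIsomorphic_of_cosets {G : Type*} [Group G] {S S' : Set G}
    {K K' : Subgroup G} (hS : S ⊆ K) (hS' : S' ⊆ K') (e : K ≃ K')
    (he : ∀ x y : K, (x : G)⁻¹ * y ∈ S ↔ (e x : G)⁻¹ * e y ∈ S') (σ : G ⧸ K ≃ G ⧸ K') :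
    (cayleyDigraph S).IsIsomorphic (cayleyDigraph S') := by
  refine ⟨⟨Subgroup.equivOfCosets e σ, ?_⟩⟩
  intro x y
  rw [cayleyDigraph_adj, cayleyDigraph_adj]
  -- Within a coset, `x⁻¹ * y` depends only on the two coordinates; between different cosets there
  -- are no arcs on either side.
  by_cases hxy : (x : G ⧸ K) = y
  · have h1 : x⁻¹ * y = (K.cosetCoord x : G)⁻¹ * K.cosetCoord y := by
      conv_lhs => rw [← K.out_mul_cosetCoord x, ← K.out_mul_cosetCoord y, hxy]
      group
    rw [h1, he]
    simp [Subgroup.equivOfCosets, hxy, mul_assoc]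
  · refine iff_of_false (fun h => hxy ?_) (fun h => hxy (QuotientGroup.eq.2 (hS h)))
    have h2 := QuotientGroup.eq.2 (hS' h)
    simp only [Subgroup.equivOfCosets, Equiv.coe_fn_mk, QuotientGroup.mk_out_mul_coe] at h2
    exact σ.injective h2

theorem Subgroup.nonempty_quotient_equiv_of_card_eq {G : Type*} [Group G] [Finite G]
    {K K' : Subgroup G} (h : Nat.card K = Nat.card K') : Nonempty (G ⧸ K ≃ G ⧸ K') := by
  have h1 := K.card_eq_card_quotient_mul_card_subgroup
  rw [K'.card_eq_card_quotient_mul_card_subgroup, h] at h1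
  exact Finite.card_eq.1 (Nat.eq_of_mul_eq_mul_right Nat.card_pos h1).symm

/-- An isomorphism between Cayley digraphs on a subgroup extends to the whole group. -/
theorem cayleyDigraph_isIsomorphic_of_subgroup {G : Type*} [Group G] {H : Subgroup G}
    {S S' : Set H} (h : (cayleyDigraph S).IsIsomorphic (cayleyDigraph S')) :
    (cayleyDigraph ((↑) '' S : Set G)).IsIsomorphic (cayleyDigraph ((↑) '' S' : Set G)) := by
  obtain ⟨φ⟩ := h
  refine cayleyDigraph_isIsomorphic_of_cosets (K := H) (K' := H) ?_ ?_ φ.toEquiv ?_ (Equiv.refl _)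
  · rintro _ ⟨s, -, rfl⟩; exact s.2
  · rintro _ ⟨s, -, rfl⟩; exact s.2
  · intro x y
    have h := φ.map_rel_iff (a := x) (b := y)
    rw [cayleyDigraph_adj, cayleyDigraph_adj] at h
    have key : ∀ (T : Set H) (a b : H), (a : G)⁻¹ * b ∈ ((↑) '' T : Set G) ↔ a⁻¹ * b ∈ T := by
      intro T a b
      rw [← Subgroup.coe_inv, ← Subgroup.coe_mul]
      exact Subtype.val_injective.mem_set_image
    rw [key, key]
    exact h.symm

/-- An isomorphism of Cayley digraphs preserves the weakly connected components. -/
theorem inv_mul_mem_closure_of_cayleyDigraph_iso {G : Type*} [Group G] {S S' : Set G}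
    (φ : (cayleyDigraph S).Adj ≃r (cayleyDigraph S').Adj) (x : G) {k : G}
    (hk : k ∈ Subgroup.closure S) : (φ x)⁻¹ * φ (x * k) ∈ Subgroup.closure S' := by
  have step : ∀ a b : G, a⁻¹ * b ∈ S → (φ a)⁻¹ * φ b ∈ Subgroup.closure S' := by
    intro a b hab
    refine Subgroup.subset_closure ?_
    rw [← cayleyDigraph_adj, φ.map_rel_iff, cayleyDigraph_adj]
    exact hab
  induction hk using Subgroup.closure_induction_right with
  | one => simp
  | mul_right k _ s hs ih =>
    have := mul_mem ih (step (x * k) (x * (k * s)) (by simpa [mul_assoc] using hs))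
    simpa [mul_assoc] using this
  | mul_inv_cancel k _ s hs ih =>
    have := mul_mem ih (inv_mem (step (x * (k * s⁻¹)) (x * k) (by simpa [mul_assoc] using hs)))
    simpa [mul_assoc] using this

/-- Isomorphic Cayley digraphs whose connection sets lie in a finite subgroup have isomorphic
restrictions to this subgroup. -/
theorem cayleyDigraph_isIsomorphic_preimage {G : Type*} [Group G] {H : Subgroup G} [Finite H]
    {S S' : Set G} (hS : S ⊆ H) (hS' : S' ⊆ H)
    (h : (cayleyDigraph S).IsIsomorphic (cayleyDigraph S')) :
    (cayleyDigraph ((↑) ⁻¹' S : Set H)).IsIsomorphic (cayleyDigraph ((↑) ⁻¹' S' : Set H)) := by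
  obtain ⟨φ⟩ := h
  have hK := (Subgroup.closure_le H).2 hS
  have hK' := (Subgroup.closure_le H).2 hS'
  have h1 : ∀ k ∈ Subgroup.closure S, (φ 1)⁻¹ * φ k ∈ Subgroup.closure S' := fun k hk => by
    simpa using inv_mul_mem_closure_of_cayleyDigraph_iso φ 1 hk
  have h2 : ∀ k ∈ Subgroup.closure S', φ.symm (φ 1 * k) ∈ Subgroup.closure S := fun k hk => by
    simpa using inv_mul_mem_closure_of_cayleyDigraph_iso φ.symm (φ 1) hk
  -- Recentring `φ` at `φ 1` carries the component of `1` to the component of `1`.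
  let e : (Subgroup.closure S).subgroupOf H ≃ (Subgroup.closure S').subgroupOf H :=
    { toFun := fun x => ⟨⟨(φ 1)⁻¹ * φ x, hK' (h1 _ x.2)⟩, h1 _ x.2⟩
      invFun := fun x => ⟨⟨φ.symm (φ 1 * x), hK (h2 _ x.2)⟩, h2 _ x.2⟩
      left_inv := fun x => by ext; simp
      right_inv := fun x => by ext; simp }
  -- `φ` may scatter the components inside `H` over the whole group, so only one component is kept;
  -- equal indices in the finite group `H` allow the others to be matched arbitrarily.
  obtain ⟨σ⟩ := Subgroup.nonempty_quotient_equiv_of_card_eq (Nat.card_congr e)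
  refine cayleyDigraph_isIsomorphic_of_cosets (K := (Subgroup.closure S).subgroupOf H)
    (K' := (Subgroup.closure S').subgroupOf H) (fun s hs => Subgroup.subset_closure hs)
    (fun s hs => Subgroup.subset_closure hs) e (fun x y => ?_) σ
  have h := φ.map_rel_iff (a := (x : G)) (b := (y : G))
  rw [cayleyDigraph_adj, cayleyDigraph_adj] at h
  simpa [e, mul_assoc] using h.symm

/-- In a finite group, subgroups of the same order have isomorphic Cayley digraphs. -/
theorem cayleyDigraph_isIsomorphic_of_card_eq {G : Type*} [Group G] [Finite G]
    {K K' : Subgroup G} (h : Nat.card K = Nat.card K') :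
    (cayleyDigraph (K : Set G)).IsIsomorphic (cayleyDigraph (K' : Set G)) := by
  obtain ⟨σ⟩ := Subgroup.nonempty_quotient_equiv_of_card_eq h
  exact cayleyDigraph_isIsomorphic_of_cosets subset_rfl subset_rfl (Finite.card_eq.1 h).some
    (fun x y => iff_of_true (mul_mem (inv_mem x.2) y.2) (mul_mem (inv_mem (Subtype.prop _))
      (Subtype.prop _))) σ

/-! ### Extending injections inside a single primary component -/

/-- An injective homomorphism from a finite subgroup of an elementary abelian `p`-group extends to
an automorphism. -/
theorem AddMonoidHom.exists_addEquiv_extend_of_zmod {V : Type*} [AddCommGroup V] {p : ℕ}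
    [Fact p.Prime] [Module (ZMod p) V] (A : AddSubgroup V) [hA : Finite A] (f : A →+ V)
    (hf : Function.Injective f) : ∃ γ : V ≃+ V, ∀ a : A, γ a = f a := by
  let W : Submodule (ZMod p) V := AddSubgroup.toZModSubmodule p A
  have : Finite W := hA
  let f' : W →ₗ[ZMod p] V := AddMonoidHom.toZModLinearMap p (M := W) f
  have hf' : Function.Injective f' := hf
  obtain ⟨g, hg⟩ := Submodule.exists_linearEquiv_restrict_eq (LinearEquiv.ofInjective f' hf')
  exact ⟨g.toAddEquiv, fun a => (hg a).symm⟩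

theorem AddMonoidHom.exists_addEquiv_extend_of_elementary {V : Type*} [AddCommGroup V] {p : ℕ}
    (hp : p.Prime) (hV : ∀ x : V, p • x = 0) (A : AddSubgroup V) [Finite A] (f : A →+ V)
    (hf : Function.Injective f) : ∃ γ : V ≃+ V, ∀ a : A, γ a = f a :=
  have := Fact.mk hp
  let _ : Module (ZMod p) V := AddCommGroup.zmodModule hV
  f.exists_addEquiv_extend_of_zmod (p := p) A hf

section PGroup

variable {V : Type*} [AddCommGroup V] {p : ℕ}

/-- In a `p`-group with a unique subgroup of order `p`, each element is a multiple of any element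
of at least the same order. -/
theorem exists_zsmul_eq_of_unique
    (hu : ∀ x y : V, p • x = 0 → p • y = 0 → x ≠ 0 → ∃ n : ℤ, y = n • x) (k : ℕ) :
    ∀ a b : V, p ^ (k + 1) • a = 0 → p ^ k • a ≠ 0 → p ^ (k + 1) • b = 0 →
      ∃ n : ℤ, b = n • a := by
  induction k with
  | zero =>
    intro a b ha ha' hb
    exact hu a b (by simpa using ha) (by simpa using hb) (by simpa using ha')
  | succ k ih =>
    intro a b ha ha' hb
    -- From `p • b = n • (p • a)`, the difference `b - n • a` is killed by `p`, hence is a multiple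
    -- of the nonzero element `p ^ (k + 1) • a`, which `p` also kills.
    obtain ⟨n, hn⟩ := ih (p • a) (p • b) (by rwa [smul_smul, ← pow_succ])
      (by rwa [smul_smul, ← pow_succ]) (by rwa [smul_smul, ← pow_succ])
    obtain ⟨m, hm⟩ := hu (p ^ (k + 1) • a) (b - n • a) (by rwa [smul_smul, ← pow_succ'])
      (by rw [smul_sub, hn, smul_comm, sub_self]) ha'
    refine ⟨m * (p ^ (k + 1) : ℕ) + n, ?_⟩
    rw [add_smul, mul_smul, natCast_zsmul, ← hm, sub_add_cancel]

/-- An element `a` of maximal order in `A` generates `A`, and `f a` is a multiple `u • a`. If `p`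
divided `u`, then `f` would kill a nonzero multiple of `a`. -/
theorem exists_forall_zsmul_eq (hp : p.Prime) (hV : ∀ x : V, ∃ k : ℕ, p ^ k • x = 0)
    (hu : ∀ x y : V, p • x = 0 → p • y = 0 → x ≠ 0 → ∃ n : ℤ, y = n • x) (A : AddSubgroup V)
    [Finite A] (f : A →+ V) (hf : Function.Injective f) :
    ∃ u : ℤ, IsCoprime u p ∧ ∀ a : A, f a = u • (a : V) := by
  classical
  choose k hk using hV
  have hE : ∃ K : ℕ, ∀ a : A, p ^ K • (a : V) = 0 := by
    obtain ⟨K, hK⟩ := (Set.finite_range fun a : A => k a).bddAbove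
    refine ⟨K, fun a => ?_⟩
    obtain ⟨c, hc⟩ := pow_dvd_pow p (hK ⟨a, rfl⟩ : k a ≤ K)
    rw [hc, mul_comm, mul_smul, hk, smul_zero]
  rcases hm : Nat.find hE with _ | m
  · have h0 := Nat.find_spec hE
    rw [hm] at h0
    refine ⟨1, isCoprime_one_left, fun a => ?_⟩
    have : a = 0 := by ext; simpa using h0 a
    simp [this]
  · have h0 := Nat.find_spec hE
    have h1 := Nat.find_min hE (m := m) (by omega)
    rw [hm] at h0
    push Not at h1
    obtain ⟨a, ha⟩ := h1
    have ha0 : p ^ (m + 1) • a = 0 := by ext; simpa using h0 a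
    have hfa : p ^ (m + 1) • f a = 0 := by rw [← map_nsmul, ha0, map_zero]
    obtain ⟨u, hu'⟩ := exists_zsmul_eq_of_unique hu m a (f a) (h0 a) ha hfa
    refine ⟨u, ?_, fun b => ?_⟩
    · rw [isCoprime_comm, Prime.coprime_iff_not_dvd (Nat.prime_iff_prime_int.1 hp)]
      rintro ⟨c, rfl⟩
      apply ha
      have : f (p ^ m • a) = 0 := by
        rw [map_nsmul, hu', smul_comm, mul_comm, mul_smul, natCast_zsmul,
          ← mul_smul p, ← pow_succ', h0, smul_zero]
      have := (injective_iff_map_eq_zero f).1 hf _ this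
      simpa using congrArg Subtype.val this
    · obtain ⟨n, hn⟩ := exists_zsmul_eq_of_unique hu m a b (h0 a) ha (h0 b)
      have : b = n • a := by ext; simpa using hn
      rw [this, map_zsmul, hu', AddSubgroup.coe_zsmul, smul_comm]

/-- An injective homomorphism from a finite subgroup of a `p`-group with a unique subgroup of
order `p` extends to an automorphism. -/
theorem AddMonoidHom.exists_addEquiv_extend_of_unique (hp : p.Prime)
    (hV : ∀ x : V, ∃ k : ℕ, p ^ k • x = 0)
    (hu : ∀ x y : V, p • x = 0 → p • y = 0 → x ≠ 0 → ∃ n : ℤ, y = n • x) (A : AddSubgroup V)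
    [Finite A] (f : A →+ V) (hf : Function.Injective f) :
    ∃ γ : V ≃+ V, ∀ a : A, γ a = f a := by
  obtain ⟨u, hup, h⟩ := exists_forall_zsmul_eq hp hV hu A f hf
  -- `u` is invertible modulo each `p ^ k`; the inverse may depend on `x`, since `V` need not have
  -- bounded exponent.
  have bez : ∀ x : V, ∃ a : ℤ, (a * u) • x = x := fun x => by
    obtain ⟨k, hk⟩ := hV x
    obtain ⟨a, b, hab⟩ := hup.pow_right (n := k)
    refine ⟨a, ?_⟩
    have := congrArg (· • x) hab
    simp only [add_smul, one_smul] at this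
    rwa [mul_smul b, ← Nat.cast_pow, natCast_zsmul, hk, smul_zero, add_zero] at this
  refine ⟨AddEquiv.ofBijective (zsmulAddGroupHom u : V →+ V) ⟨?_, ?_⟩, fun a => (h a).symm⟩
  · refine (injective_iff_map_eq_zero _).2 fun x hx => ?_
    obtain ⟨a, ha⟩ := bez x
    rw [← ha, mul_smul, show u • x = 0 from hx, smul_zero]
  · intro x
    obtain ⟨a, ha⟩ := bez x
    exact ⟨a • x, by rw [zsmulAddGroupHom_apply, smul_smul, mul_comm, ha]⟩

end PGroup

/-! ### Splitting off a primary component -/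

section Components

variable (M : Type*) [AddCommGroup M] (p : ℕ)

/-- The elements of `p`-power order. -/
def pPart : Submodule ℤ M where
  carrier := {x | ∃ k : ℕ, p ^ k • x = 0}
  zero_mem' := ⟨0, smul_zero _⟩
  add_mem' := by
    rintro x y ⟨k, hk⟩ ⟨l, hl⟩
    refine ⟨k + l, ?_⟩
    rw [smul_add, pow_add, mul_smul _ _ y, hl, mul_comm, mul_smul, hk, smul_zero, smul_zero,
      add_zero]
  smul_mem' := by
    rintro c x ⟨k, hk⟩
    exact ⟨k, by rw [smul_comm, hk, smul_zero]⟩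

/-- The elements of order prime to `p`. -/
def primeToPart : Submodule ℤ M where
  carrier := {x | ∃ m : ℕ, m.Coprime p ∧ m • x = 0}
  zero_mem' := ⟨1, Nat.coprime_one_left p, smul_zero _⟩
  add_mem' := by
    rintro x y ⟨k, hkp, hk⟩ ⟨l, hlp, hl⟩
    refine ⟨k * l, hkp.mul_left hlp, ?_⟩
    rw [smul_add, mul_smul _ _ y, hl, mul_comm, mul_smul, hk, smul_zero, smul_zero, add_zero]
  smul_mem' := by
    rintro c x ⟨k, hkp, hk⟩
    exact ⟨k, hkp, by rw [smul_comm, hk, smul_zero]⟩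

variable {M p}

theorem eq_zero_of_coprime_smul {a b : ℕ} (hab : a.Coprime b) {x : M} (ha : a • x = 0)
    (hb : b • x = 0) : x = 0 := by
  have h1 := addOrderOf_dvd_of_nsmul_eq_zero ha
  have h2 := addOrderOf_dvd_of_nsmul_eq_zero hb
  exact AddMonoid.addOrderOf_eq_one_iff.1 (Nat.eq_one_of_dvd_coprimes hab h1 h2)

theorem exists_add_of_coprime_smul {a b : ℕ} (hab : a.Coprime b) {x : M}
    (h : (a * b) • x = 0) : ∃ m n : ℤ, a • (m • x) = 0 ∧ b • (n • x) = 0 ∧ m • x + n • x = x := by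
  obtain ⟨u, v, huv⟩ := Nat.isCoprime_iff_coprime.2 hab
  refine ⟨v * b, u * a, ?_, ?_, ?_⟩
  · rw [mul_smul, natCast_zsmul, smul_comm, ← mul_smul a b, h, smul_zero]
  · rw [mul_smul, natCast_zsmul, smul_comm, ← mul_smul b a, mul_comm, h, smul_zero]
  · rw [← add_smul, add_comm, huv, one_smul]

theorem isCompl_pPart_primeToPart (hp : p.Prime) (hM : ∀ x : M, ∃ n : ℕ, n ≠ 0 ∧ n • x = 0) :
    IsCompl (pPart M p) (primeToPart M p) := by
  constructor
  · rw [Submodule.disjoint_def]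
    rintro x ⟨k, hk⟩ ⟨m, hmp, hm⟩
    exact eq_zero_of_coprime_smul (hmp.symm.pow_left k) hk hm
  · rw [codisjoint_iff, Submodule.eq_top_iff']
    intro x
    obtain ⟨n, hn, hx⟩ := hM x
    obtain ⟨k, m, hm, rfl⟩ := Nat.exists_eq_pow_mul_and_not_dvd hn p hp.ne_one
    have hc : m.Coprime p := ((Nat.Prime.coprime_iff_not_dvd hp).2 hm).symm
    obtain ⟨u, v, hu, hv, h⟩ := exists_add_of_coprime_smul (hc.symm.pow_left k) hx
    exact Submodule.mem_sup.2 ⟨_, ⟨k, hu⟩, _, ⟨m, hc, hv⟩, h⟩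

end Components

/-! ### Extending injections from finite subgroups of a torsion group -/

/-- For each prime `p`, either there is no element of order `p ^ 2` or the subgroup of order `p` is
unique. -/
def ElementaryOrUnique (M : Type*) [AddCommGroup M] : Prop :=
  ∀ p : ℕ, p.Prime → (∀ x : M, p ^ 2 • x = 0 → p • x = 0) ∨
    (∀ x y : M, p • x = 0 → p • y = 0 → x ≠ 0 → ∃ n : ℤ, y = n • x)

section Extension

variable {M : Type*} [AddCommGroup M]

/-- The restriction of `f` to `p`-power elements stays in the `p`-component and extends there;
taking the identity on the complement lets corrections at different primes be composed without
interference. -/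
theorem AddMonoidHom.exists_addEquiv_extend_pPart (hM : ∀ x : M, ∃ n : ℕ, n ≠ 0 ∧ n • x = 0)
    (h : ElementaryOrUnique M) {p : ℕ} (hp : p.Prime) (A : AddSubgroup M) [Finite A] (f : A →+ M)
    (hf : Function.Injective f) :
    ∃ β : M ≃+ M, (∀ a : A, (a : M) ∈ pPart M p → β a = f a) ∧
      ∀ x ∈ primeToPart M p, β x = x := by
  have hc := isCompl_pPart_primeToPart hp hM
  let B : AddSubgroup (pPart M p) := A.comap (pPart M p).subtype.toAddMonoidHom
  let ι : B →+ A := ((pPart M p).subtype.toAddMonoidHom.comp B.subtype).codRestrict A fun b => b.2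
  have hι : Function.Injective ι := fun b c hbc => by
    ext; exact congrArg (Subtype.val : A → M) hbc
  have : Finite B := Finite.of_injective ι hι
  let g : B →+ pPart M p := (f.comp ι).codRestrict (pPart M p) fun b => by
    obtain ⟨k, hk⟩ := b.1.2
    have : p ^ k • ι b = 0 := Subtype.ext hk
    exact ⟨k, by rw [AddMonoidHom.comp_apply, ← map_nsmul, this, map_zero]⟩
  have hg : Function.Injective g := fun b c hbc =>
    hι (hf (congrArg (Subtype.val : pPart M p → M) hbc))
  have hV : ∀ x : pPart M p, ∃ k : ℕ, p ^ k • x = 0 := fun x => by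
    obtain ⟨k, hk⟩ := x.2
    exact ⟨k, by ext; simpa using hk⟩
  have key : ∃ γ : pPart M p ≃+ pPart M p, ∀ b : B, γ b = g b := by
    rcases h p hp with h | h
    · refine g.exists_addEquiv_extend_of_elementary hp (fun x => ?_) B hg
      have : ∀ k : ℕ, ∀ y : M, p ^ k • y = 0 → p • y = 0 := by
        intro k
        induction k with
        | zero => intro y hy; rw [pow_zero, one_smul] at hy; rw [hy, smul_zero]
        | succ k ih =>
          intro y hy
          apply h
          rw [pow_two, mul_smul]
          exact ih _ (by rwa [← mul_smul, ← pow_succ])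
      obtain ⟨k, hk⟩ := x.2
      ext
      simpa using this k _ hk
    · refine g.exists_addEquiv_extend_of_unique hp hV (fun x y hx hy hx0 => ?_) B hg
      obtain ⟨n, hn⟩ := h x y (by simpa using congrArg Subtype.val hx)
        (by simpa using congrArg Subtype.val hy) (by simpa using hx0)
      exact ⟨n, by ext; simpa using hn⟩
  obtain ⟨γ, hγ⟩ := key
  let e := (Submodule.prodEquivOfIsCompl _ _ hc).toAddEquiv
  refine ⟨(e.symm.trans (γ.prodCongr (AddEquiv.refl _))).trans e, fun a ha => ?_, fun x hx => ?_⟩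
  · have h1 : e.symm (a : M) = ((⟨a, ha⟩, 0) : ↥(pPart M p) × ↥(primeToPart M p)) := Submodule.prodEquivOfIsCompl_symm_apply_left _ _ hc (⟨a, ha⟩ : ↥(pPart M p))
    have h2 : γ ⟨a, ha⟩ = g ⟨⟨a, ha⟩, a.2⟩ := hγ ⟨⟨a, ha⟩, a.2⟩
    rw [AddEquiv.trans_apply, AddEquiv.trans_apply, h1]
    change ((γ ⟨a, ha⟩ : pPart M p) : M) + ((0 : primeToPart M p) : M) = f a
    rw [h2, Submodule.coe_zero, add_zero]
    rfl
  · have h1 : e.symm x = ((0, ⟨x, hx⟩) : ↥(pPart M p) × ↥(primeToPart M p)) := Submodule.prodEquivOfIsCompl_symm_apply_right _ _ hc (⟨x, hx⟩ : ↥(primeToPart M p))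
    rw [AddEquiv.trans_apply, AddEquiv.trans_apply, h1]
    change ((γ 0 : pPart M p) : M) + x = x
    rw [map_zero, Submodule.coe_zero, zero_add]

/-- Extension of injective homomorphisms from finite subgroups to automorphisms. -/
theorem AddMonoidHom.exists_addEquiv_extend (hM : ∀ x : M, ∃ n : ℕ, n ≠ 0 ∧ n • x = 0)
    (h : ElementaryOrUnique M) (A : AddSubgroup M) [Finite A] (f : A →+ M)
    (hf : Function.Injective f) : ∃ β : M ≃+ M, ∀ a : A, β a = f a := by
  classical
  have hpp : ∀ p q : ℕ, p.Prime → q.Prime → p ≠ q → pPart M p ≤ primeToPart M q := by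
    rintro p q hp hq hpq x ⟨k, hk⟩
    exact ⟨p ^ k, ((Nat.coprime_primes hp hq).2 hpq).pow_left k, hk⟩
  have hfp : ∀ (p : ℕ) (a : A), (a : M) ∈ pPart M p → f a ∈ pPart M p := by
    rintro p a ⟨k, hk⟩
    have : p ^ k • a = 0 := by ext; simpa using hk
    exact ⟨k, by rw [← map_nsmul, this, map_zero]⟩
  have step : ∀ T : Finset ℕ, (∀ p ∈ T, p.Prime) → ∃ β : M ≃+ M,
      (∀ p ∈ T, ∀ a : A, (a : M) ∈ pPart M p → β a = f a) ∧
      ∀ q, q.Prime → q ∉ T → ∀ x ∈ pPart M q, β x = x := by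
    intro T
    induction T using Finset.induction_on with
    | empty => exact fun _ => ⟨AddEquiv.refl M, by simp, fun _ _ _ _ _ => rfl⟩
    | insert p T hpT ih =>
      intro hT
      obtain ⟨β, h1, h2⟩ := ih fun q hq => hT q (Finset.mem_insert_of_mem hq)
      have hp := hT p (Finset.mem_insert_self _ _)
      obtain ⟨γ, h3, h4⟩ := f.exists_addEquiv_extend_pPart hM h hp A hf
      refine ⟨β.trans γ, fun q hq a ha => ?_, fun q hq hqT x hx => ?_⟩
      · rw [AddEquiv.trans_apply]
        by_cases hqp : q = p
        · subst hqp
          rw [h2 q hp hpT _ ha, h3 a ha]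
        · have hqT := (Finset.mem_insert.1 hq).resolve_left hqp
          rw [h1 q hqT a ha]
          exact h4 _ (hpp q p (hT q hq) hp hqp (hfp q a ha))
      · rw [Finset.mem_insert, not_or] at hqT
        rw [AddEquiv.trans_apply, h2 q hq hqT.2 x hx, h4 x (hpp q p hq hp hqT.1 hx)]
  -- Only the primes dividing the order of `A` matter; every element of `A` is then split into parts
  -- of prime power order.
  obtain ⟨β, hβ, -⟩ := step (Nat.card A).primeFactors fun p => Nat.prime_of_mem_primeFactors
  refine ⟨β, ?_⟩
  have key : ∀ n : ℕ, n ∣ Nat.card A → ∀ a : A, n • a = 0 → β a = f a := by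
    intro n
    induction n using Nat.recOnPrimeCoprime with
    | zero => exact fun h0 => absurd (Nat.eq_zero_of_zero_dvd h0) Nat.card_pos.ne'
    | prime_pow p k hp =>
      intro hd a ha
      rcases Nat.eq_zero_or_pos k with rfl | hk
      · have : a = 0 := by simpa using ha
        simp [this]
      · refine hβ p (Nat.mem_primeFactors.2 ⟨hp, (dvd_pow_self p hk.ne').trans hd,
          Nat.card_pos.ne'⟩) a ⟨k, ?_⟩
        simpa using congrArg (Subtype.val : A → M) ha
    | coprime m n _ _ hmn ihm ihn =>
      intro hd a ha
      obtain ⟨u, v, hu, hv, huv⟩ := exists_add_of_coprime_smul hmn ha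
      have h1 := ihm ((dvd_mul_right _ _).trans hd) _ hu
      have h2 := ihn ((dvd_mul_left _ _).trans hd) _ hv
      rw [← huv, map_add, ← h1, ← h2, ← map_add, AddSubgroup.coe_add]
  exact fun a => key _ dvd_rfl a (card_nsmul_eq_zero' (x := a))

end Extension

theorem ElementaryOrUnique.of_injective {M N : Type*} [AddCommGroup M] [AddCommGroup N]
    (h : ElementaryOrUnique M) (ι : N →+ M) (hι : Function.Injective ι) :
    ElementaryOrUnique N := by
  have h0 : ∀ (n : ℕ) (x : N), n • x = 0 ↔ n • ι x = 0 := fun n x => by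
    rw [← map_nsmul, map_eq_zero_iff ι hι]
  intro p hp
  refine (h p hp).imp (fun h x => ?_) (fun h x y => ?_)
  · rw [h0, h0]
    exact h _
  · rw [h0, h0, ← map_ne_zero_iff ι hι]
    intro hx hy hx0
    obtain ⟨n, hn⟩ := h _ _ hx hy hx0
    exact ⟨n, hι (by rw [hn, map_zsmul])⟩

/-! ### The condition forced by the CI property -/

section Torsion

variable {G : Type*} [CommGroup G]

theorem MonoidHom.exists_mulEquiv_extend (hG : IsMulTorsion G)
    (h : ElementaryOrUnique (Additive G)) (A : Subgroup G) [hA : Finite A] (f : A →* G)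
    (hf : Function.Injective f) : ∃ β : G ≃* G, ∀ a : A, β a = f a := by
  have : Finite (Subgroup.toAddSubgroup A) := hA
  obtain ⟨β, hβ⟩ := AddMonoidHom.exists_addEquiv_extend (M := Additive G)
    (fun x => ⟨orderOf x.toMul, (hG x.toMul).orderOf_pos.ne', pow_orderOf_eq_one x.toMul⟩) h
    (Subgroup.toAddSubgroup A) (MonoidHom.toAdditive f) hf
  exact ⟨MulEquiv.toAdditive.symm β, hβ⟩

theorem Subgroup.finite_closure_of_isMulTorsion (hG : IsMulTorsion G) {S : Set G}
    (hS : S.Finite) : Finite (Subgroup.closure S) := by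
  have := hS.to_subtype
  exact CommGroup.finite_of_fg_isMulTorsion _ (hG.subgroup _)

/-- If finite subgroups are determined up to isomorphism by their orders, then for every prime `p`
the `p`-component is elementary abelian or has a unique subgroup of order `p`. -/
theorem elementaryOrUnique_of_card_eq
    (h : ∀ K L : Subgroup G, Finite K → Finite L → Nat.card K = Nat.card L →
      Nonempty (K ≃* L)) : ElementaryOrUnique (Additive G) := by
  intro p hp
  have := Fact.mk hp
  suffices H : (∀ x : G, x ^ p ^ 2 = 1 → x ^ p = 1) ∨
      (∀ x y : G, x ^ p = 1 → y ^ p = 1 → x ≠ 1 → ∃ n : ℤ, y = x ^ n) from H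
  by_contra! ⟨⟨z, hz, hz'⟩, x, y, hx, hy, hx1, hxy⟩
  have hy1 : y ≠ 1 := fun h => hxy 0 (by simpa using h)
  have ox : Nat.card (Subgroup.zpowers x) = p := by rw [Nat.card_zpowers, orderOf_eq_prime hx hx1]
  have oy : Nat.card (Subgroup.zpowers y) = p := by rw [Nat.card_zpowers, orderOf_eq_prime hy hy1]
  have oz : Nat.card (Subgroup.zpowers z) = p ^ 2 := by
    rw [Nat.card_zpowers, orderOf_eq_prime_pow (by rwa [pow_one]) hz]
  have fx : Finite (Subgroup.zpowers x) := Nat.finite_of_card_ne_zero (ox ▸ hp.ne_zero)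
  have fy : Finite (Subgroup.zpowers y) := Nat.finite_of_card_ne_zero (oy ▸ hp.ne_zero)
  have fz : Finite (Subgroup.zpowers z) :=
    Nat.finite_of_card_ne_zero (oz ▸ (pow_ne_zero _ hp.ne_zero))
  -- A common element other than `1` would generate both groups of prime order, making `y` a power
  -- of `x`.
  have key : ∀ a ∈ Subgroup.zpowers x, a ∈ Subgroup.zpowers y → a = 1 := by
    intro a hax hay
    by_contra ha
    obtain ⟨n, hn⟩ := Subgroup.mem_zpowers_iff.1 hax
    have hap : a ^ p = 1 := by rw [← hn, ← zpow_natCast, zpow_comm, zpow_natCast, hx, one_zpow]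
    have oa : Nat.card (Subgroup.zpowers a) = p := by
      rw [Nat.card_zpowers, orderOf_eq_prime hap ha]
    have h1 := Subgroup.eq_of_le_of_card_ge (Subgroup.zpowers_le.2 hax) (by rw [ox, oa])
    have h2 := Subgroup.eq_of_le_of_card_ge (Subgroup.zpowers_le.2 hay) (by rw [oy, oa])
    have : y ∈ Subgroup.zpowers x := by rw [← h1, h2]; exact Subgroup.mem_zpowers y
    obtain ⟨m, hm⟩ := Subgroup.mem_zpowers_iff.1 this
    exact hxy m hm.symm
  let c := (Subgroup.zpowers x).subtype.coprod (Subgroup.zpowers y).subtype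
  have hc : Function.Injective c := by
    refine (injective_iff_map_eq_one c).2 ?_
    rintro ⟨a, b⟩ hab
    have hab' : (a : G) * b = 1 := hab
    have ha : (a : G) = 1 := key a a.2 (by
      rw [eq_inv_of_mul_eq_one_left hab']
      exact inv_mem b.2)
    have hb : (b : G) = 1 := by rwa [ha, one_mul] at hab'
    exact Prod.ext (Subtype.ext ha) (Subtype.ext hb)
  -- The range of `c` has order `p ^ 2` and exponent `p`, unlike the cyclic group generated by `z`.
  obtain ⟨e⟩ := h (Subgroup.zpowers z) c.range fz (Set.finite_range c).to_subtype (by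
    rw [oz, ← Nat.card_congr (MonoidHom.ofInjective hc).toEquiv, Nat.card_prod, ox, oy, pow_two])
  have hrange : ∀ w : c.range, w ^ p = 1 := by
    rintro ⟨_, ⟨⟨⟨_, i, rfl⟩, ⟨_, j, rfl⟩⟩, rfl⟩⟩
    ext
    have : (x ^ i * y ^ j) ^ p = 1 := by
      rw [mul_pow, ← zpow_natCast, ← zpow_natCast, zpow_comm, zpow_comm y, zpow_natCast,
        zpow_natCast, hx, hy, one_zpow, one_zpow, one_mul]
    exact this
  have h1 := hrange (e ⟨z, Subgroup.mem_zpowers z⟩)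
  rw [← map_pow, map_eq_one_iff e e.injective] at h1
  exact hz' (congrArg Subtype.val h1)

theorem Subgroup.exists_finite_ge (hG : IsMulTorsion G) (K L : Subgroup G) [Finite K] [Finite L] :
    ∃ H : Subgroup G, Finite H ∧ K ≤ H ∧ L ≤ H :=
  ⟨_, Subgroup.finite_closure_of_isMulTorsion hG ((K : Set G).toFinite.union (L : Set G).toFinite),
    fun _ hx => Subgroup.subset_closure (Or.inl hx),
    fun _ hx => Subgroup.subset_closure (Or.inr hx)⟩

theorem Subgroup.image_preimage_coe_of_subset {G : Type*} [Group G] {H : Subgroup G} {T : Set G}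
    (hT : T ⊆ H) : ((↑) '' ((↑) ⁻¹' T : Set H) : Set G) = T :=
  (Set.image_preimage_subset _ _).antisymm fun x hx => ⟨⟨x, hT hx⟩, hx, rfl⟩

theorem nonempty_mulEquiv_of_image_eq {G : Type*} [Group G] {K L : Subgroup G} (α : G ≃* G)
    (h : α '' (K : Set G) = L) : Nonempty (K ≃* L) :=
  ⟨(α.subgroupMap K).trans (MulEquiv.subgroupCongr (SetLike.coe_injective h))⟩

theorem elementaryOrUnique_of_isCIGroup (hG : IsMulTorsion G)
    (h : ∀ H : Subgroup G, Finite H → IsCIGroup H) : ElementaryOrUnique (Additive G) := by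
  refine elementaryOrUnique_of_card_eq fun K L _ _ hKL => ?_
  obtain ⟨H, hH, hK, hL⟩ := Subgroup.exists_finite_ge hG K L
  let eK := Subgroup.subgroupOfEquivOfLe hK
  let eL := Subgroup.subgroupOfEquivOfLe hL
  obtain ⟨α, hα⟩ := h H hH (K.subgroupOf H) inv_coe_set (L.subgroupOf H) inv_coe_set
    (cayleyDigraph_isIsomorphic_of_card_eq
      (by rw [Nat.card_congr eK.toEquiv, Nat.card_congr eL.toEquiv, hKL]))
  obtain ⟨e⟩ := nonempty_mulEquiv_of_image_eq α hα
  exact ⟨(eK.symm.trans e).trans eL⟩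

theorem elementaryOrUnique_of_isStronglyCIfGroup (hG : IsMulTorsion G)
    (h : IsStronglyCIfGroup G) : ElementaryOrUnique (Additive G) := by
  refine elementaryOrUnique_of_card_eq fun K L _ _ hKL => ?_
  obtain ⟨H, hH, hK, hL⟩ := Subgroup.exists_finite_ge hG K L
  -- The isomorphism is built in the finite group `H`, where equal orders give equal indices, and
  -- then lifted to `G`.
  have hiso := cayleyDigraph_isIsomorphic_of_subgroup (cayleyDigraph_isIsomorphic_of_card_eq
    (K := K.subgroupOf H) (K' := L.subgroupOf H)
    (by rw [Nat.card_congr (Subgroup.subgroupOfEquivOfLe hK).toEquiv,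
      Nat.card_congr (Subgroup.subgroupOfEquivOfLe hL).toEquiv, hKL]))
  rw [Subgroup.coe_subgroupOf, Subgroup.coe_subgroupOf, Subgroup.coe_subtype,
    Subgroup.image_preimage_coe_of_subset hK, Subgroup.image_preimage_coe_of_subset hL] at hiso
  obtain ⟨α, hα⟩ := h K inv_coe_set ((cayleyDigraph_isLocallyFinite_iff _).2 (Set.toFinite _)) L
    inv_coe_set hiso
  exact nonempty_mulEquiv_of_image_eq α hα

/-! ### Passing between the group and its finite subgroups -/

/-- Restricting an automorphism that matches two subsets of a finite subgroup. -/
theorem exists_mulEquiv_subgroup_image_eq (hG : IsMulTorsion G)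
    (h : ElementaryOrUnique (Additive G)) {H : Subgroup G} [Finite H] {S S' : Set H}
    (α : G ≃* G) (hα : α '' ((↑) '' S) = (↑) '' S') : ∃ β : H ≃* H, β '' S = S' := by
  -- `α` need not preserve `H`, but it sends the subgroup generated by `S` into `H`; that
  -- restriction is extended afresh within `H`.
  have hmem : Subgroup.closure S ≤ H.comap (α.toMonoidHom.comp H.subtype) := by
    rw [Subgroup.closure_le]
    intro s hs
    have : α s ∈ ((↑) '' S' : Set G) := hα ▸ ⟨s, ⟨s, hs, rfl⟩, rfl⟩
    obtain ⟨t, -, ht⟩ := this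
    exact (ht ▸ t.2 : α s ∈ H)
  let f : Subgroup.closure S →* H :=
    ((α.toMonoidHom.comp H.subtype).comp (Subgroup.closure S).subtype).codRestrict H
      fun a => hmem a.2
  have hf : Function.Injective f := fun a b hab =>
    Subtype.ext (Subtype.ext (α.injective (congrArg (Subtype.val : H → G) hab)))
  obtain ⟨β, hβ⟩ := f.exists_mulEquiv_extend (hG.subgroup H)
    (h.of_injective (MonoidHom.toAdditive H.subtype) Subtype.val_injective) _ hf
  refine ⟨β, Subtype.val_injective.image_injective ?_⟩
  rw [← hα, Set.image_image, Set.image_image]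
  exact Set.image_congr fun s hs =>
    congrArg Subtype.val (hβ ⟨s, Subgroup.subset_closure hs⟩)

/-- Extending an automorphism of a finite subgroup that matches two subsets. -/
theorem exists_mulEquiv_image_eq_of_subgroup (hG : IsMulTorsion G)
    (h : ElementaryOrUnique (Additive G)) {H : Subgroup G} [Finite H] {S S' : Set G}
    (hS : S ⊆ H) (hS' : S' ⊆ H) (α : H ≃* H) (hα : α '' ((↑) ⁻¹' S) = (↑) ⁻¹' S') :
    ∃ β : G ≃* G, β '' S = S' := by
  obtain ⟨β, hβ⟩ := (H.subtype.comp α.toMonoidHom).exists_mulEquiv_extend hG h H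
    (Subtype.val_injective.comp α.injective)
  refine ⟨β, ?_⟩
  rw [← Subgroup.image_preimage_coe_of_subset hS', ← hα, ← Subgroup.image_preimage_coe_of_subset hS,
    Set.image_image, Set.image_image, Subgroup.image_preimage_coe_of_subset hS]
  exact Set.image_congr fun s _ => hβ s

/-- Isomorphic locally finite Cayley digraphs restrict to isomorphic Cayley digraphs on some finite
subgroup. -/
theorem exists_finite_subgroup_isIsomorphic (hG : IsMulTorsion G) {S S' : Set G}
    (hS : (cayleyDigraph S).IsLocallyFinite)
    (h : (cayleyDigraph S).IsIsomorphic (cayleyDigraph S')) :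
    ∃ H : Subgroup G, Finite H ∧ S ⊆ H ∧ S' ⊆ H ∧
      (cayleyDigraph ((↑) ⁻¹' S : Set H)).IsIsomorphic
        (cayleyDigraph ((↑) ⁻¹' S' : Set H)) := by
  have hSf := (cayleyDigraph_isLocallyFinite_iff S).1 hS
  have hSf' : S'.Finite := by
    obtain ⟨φ⟩ := h
    -- `S'` is the out-neighbourhood of `1`, hence the image of the finite out-neighbourhood of
    -- `φ.symm 1`.
    refine ((hS (φ.symm 1)).1.image φ).subset fun s hs => ⟨φ.symm s, ?_, by simp⟩
    rw [Set.mem_ofPred_eq, φ.symm.map_rel_iff, cayleyDigraph_adj]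
    simpa using hs
  have hfin := Subgroup.finite_closure_of_isMulTorsion hG (hSf.union hSf')
  have h1 : S ⊆ Subgroup.closure (S ∪ S') := Set.subset_union_left.trans Subgroup.subset_closure
  have h2 : S' ⊆ Subgroup.closure (S ∪ S') := Set.subset_union_right.trans Subgroup.subset_closure
  exact ⟨_, hfin, h1, h2, cayleyDigraph_isIsomorphic_preimage h1 h2 h⟩

end Torsion

/-! ### From digraphs to graphs, and the two equivalences -/

theorem IsDCIGroup.isCIGroup {G : Type*} [Group G] (h : IsDCIGroup G) : IsCIGroup G :=
  fun S _ S' _ => h S S'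

theorem IsStronglyDCIfGroup.isStronglyCIfGroup {G : Type*} [Group G]
    (h : IsStronglyDCIfGroup G) : IsStronglyCIfGroup G :=
  fun S _ hf S' _ => h S hf S'

theorem Subgroup.image_coe_inv {G : Type*} [Group G] {H : Subgroup G} {S : Set H}
    (hS : S⁻¹ = S) : ((↑) '' S : Set G)⁻¹ = (↑) '' S := by
  have h := Set.image_inv H.subtype S
  rw [hS] at h
  exact h.symm

theorem Subgroup.preimage_coe_inv {G : Type*} [Group G] {H : Subgroup G} {S : Set G}
    (hS : S⁻¹ = S) : ((↑) ⁻¹' S : Set H)⁻¹ = (↑) ⁻¹' S :=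
  congrArg (fun T : Set G => ((↑) ⁻¹' T : Set H)) hS

theorem cayleyDigraph_image_coe_isLocallyFinite {G : Type*} [Group G] {H : Subgroup G} [Finite H]
    (S : Set H) : (cayleyDigraph ((↑) '' S : Set G)).IsLocallyFinite :=
  (cayleyDigraph_isLocallyFinite_iff _).2 (S.toFinite.image _)

theorem mainTheorem4 (G : Type*) [CommGroup G] [Countable G] (hG : IsMulTorsion G) :
    (IsStronglyCIfGroup G ↔ ∀ H : Subgroup G, Finite H → IsCIGroup H) ∧
    (IsStronglyDCIfGroup G ↔ ∀ H : Subgroup G, Finite H → IsDCIGroup H) := by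
  refine ⟨⟨fun h H _ S hS S' hS' hiso => ?_, fun h S hS hf S' hS' hiso => ?_⟩,
    ⟨fun h H _ S S' hiso => ?_, fun h S hf S' hiso => ?_⟩⟩
  · obtain ⟨α, hα⟩ := h _ (Subgroup.image_coe_inv hS)
      (cayleyDigraph_image_coe_isLocallyFinite S) _ (Subgroup.image_coe_inv hS')
      (cayleyDigraph_isIsomorphic_of_subgroup hiso)
    exact exists_mulEquiv_subgroup_image_eq hG (elementaryOrUnique_of_isStronglyCIfGroup hG h) α hα
  · obtain ⟨H, hH, h1, h2, hiso'⟩ := exists_finite_subgroup_isIsomorphic hG hf hiso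
    obtain ⟨α, hα⟩ := h H hH _ (Subgroup.preimage_coe_inv hS) _
      (Subgroup.preimage_coe_inv hS') hiso'
    exact exists_mulEquiv_image_eq_of_subgroup hG (elementaryOrUnique_of_isCIGroup hG h) h1 h2 α hα
  · obtain ⟨α, hα⟩ := h _ (cayleyDigraph_image_coe_isLocallyFinite S) _
      (cayleyDigraph_isIsomorphic_of_subgroup hiso)
    exact exists_mulEquiv_subgroup_image_eq hG
      (elementaryOrUnique_of_isStronglyCIfGroup hG h.isStronglyCIfGroup) α hα
  · obtain ⟨H, hH, h1, h2, hiso'⟩ := exists_finite_subgroup_isIsomorphic hG hf hiso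
    obtain ⟨α, hα⟩ := h H hH _ _ hiso'
    exact exists_mulEquiv_image_eq_of_subgroup hG
      (elementaryOrUnique_of_isCIGroup hG fun H hH => (h H hH).isCIGroup) h1 h2 α hα
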